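/- Let $n \ge 2$ be an integer. Every permutation group $\Gamma \le S_n$ acts linearly on $\mathbb{R}^n$ by permuting coordinates. A point $z \in \mathbb{Z}^n$ is called a core point with respect to $\Gamma$ if $\operatorname{conv}(\Gamma z) \cap \mathbb{Z}^n = \Gamma z$. A linear subspace $V \subseteq \mathbb{R}^n$ is called $\Gamma$-invariant if $\gamma V = V$ for all $\gamma \in \Gamma$, and $\operatorname{fix}(\Gamma)$ denotes the subspace of all $x \in \mathbb{R}^n$ with $\gamma x = x$ for all $\gamma \in \Gamma$. Then there exists a constant $C(n)$, depending only on $n$, such that for every transitive permutation group $\Gamma \le S_n$ the following holds: $\operatorname{fix}(\Gamma) = \operatorname{span}(\mathbb{1})$, where $\mathbb{1}$ is the all-ones vector, and for every core point $z$ with respect to $\Gamma$ there exists a nonzero $\Gamma$-invariant subspace $V \subseteq \mathbb{R}^n$ with $V \ne \operatorname{fix}(\Gamma) = \operatorname{span}(\mathbb{1})$ such that the orthogonal projection $z|_V$ of $z$ onto $V$ satisfies $\|z|_V\| \le C(n)$ in the Euclidean norm. -/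

import Mathlib

namespace CorePoints

/-- The canonical linear (orthogonal) action of a permutation on Euclidean space by permuting
coordinates, `(σ x) i = x (σ⁻¹ i)`, i.e. `σ e_j = e_{σ j}` (see `permAct_apply`). -/
noncomputable def permAct {n : ℕ} (σ : Equiv.Perm (Fin n)) :
    EuclideanSpace ℝ (Fin n) ≃ₗᵢ[ℝ] EuclideanSpace ℝ (Fin n) :=
  LinearIsometryEquiv.piLpCongrLeft 2 ℝ ℝ σ

theorem permAct_apply {n : ℕ} (σ : Equiv.Perm (Fin n)) (x : EuclideanSpace ℝ (Fin n))
    (i : Fin n) : permAct σ x i = x (σ⁻¹ i) := by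
  simp [permAct, LinearIsometryEquiv.piLpCongrLeft_apply, Equiv.piCongrLeft'_apply,
    Equiv.Perm.inv_def]

/-- The all-ones vector. -/
noncomputable def ones (n : ℕ) : EuclideanSpace ℝ (Fin n) := WithLp.toLp 2 (fun _ => (1 : ℝ))

/-- The integral points `ℤⁿ ⊂ ℝⁿ`. -/
def integralPoints (n : ℕ) : Set (EuclideanSpace ℝ (Fin n)) :=
  {x | ∀ i, ∃ m : ℤ, x i = (m : ℝ)}

/-- The orbit `Γ z`. -/
def orbit {n : ℕ} (Γ : Subgroup (Equiv.Perm (Fin n))) (z : EuclideanSpace ℝ (Fin n)) :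
    Set (EuclideanSpace ℝ (Fin n)) :=
  {x | ∃ γ ∈ Γ, permAct γ z = x}

/-- `z` is a core point with respect to `Γ`: it is integral, and the only integral points of the
orbit polytope `conv (Γ z)` are those of `Γ z`. -/
def IsCorePoint {n : ℕ} (Γ : Subgroup (Equiv.Perm (Fin n))) (z : EuclideanSpace ℝ (Fin n)) :
    Prop :=
  z ∈ integralPoints n ∧ convexHull ℝ (orbit Γ z) ∩ integralPoints n = orbit Γ z

/-- `V` is setwise fixed by every element of `Γ`. -/
def IsInvariantSubspace {n : ℕ} (Γ : Subgroup (Equiv.Perm (Fin n)))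
    (V : Submodule ℝ (EuclideanSpace ℝ (Fin n))) : Prop :=
  ∀ γ ∈ Γ, permAct γ '' (V : Set (EuclideanSpace ℝ (Fin n))) = V

/-- The fixed space `fix(Γ)` of all pointwise fixed vectors. -/
noncomputable def fixedSpace {n : ℕ} (Γ : Subgroup (Equiv.Perm (Fin n))) :
    Submodule ℝ (EuclideanSpace ℝ (Fin n)) where
  carrier := {x | ∀ γ ∈ Γ, permAct γ x = x}
  add_mem' := by
    intro a b ha hb γ hγ
    rw [map_add, ha γ hγ, hb γ hγ]
  zero_mem' := by
    intro γ _
    exact map_zero _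
  smul_mem' := by
    intro c x hx γ hγ
    rw [map_smul, hx γ hγ]

end CorePoints

/-!
The orbit polytope `P = conv (Γ z)` lies in the hyperplane `∑ xᵢ = k`, where `k = ∑ zᵢ`. This
hyperplane contains an integral point `p` with entries `q` and `q + 1` only
(`exists_integral_near_diagonal`), hence within distance `√n` of the diagonal.

If `p ∈ P`, then the core property makes `z` a permutation of `p`, and the projection of `z` onto
the orthogonal complement of the all-ones vector has norm at most `√n`.

If `p ∉ P`, a separating functional, made orthogonal to the all-ones vector, yields `w ≠ 0` with
`⟪γ w, z⟫ ≤ √n ‖w‖` for all `γ ∈ Γ` (`exists_separating_vector`). Since `Γ` is transitive,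
`∑ γ, γ w = 0`, so these upper bounds imply two-sided ones, and `∑ γ, ⟪γ w, z⟫ ^ 2` is bounded by a
constant times `‖w‖ ^ 2` (`sum_sq_le_of_sum_eq_zero`). This sum is the value at `z` of the quadratic
form of the positive semidefinite operator `M = ∑ γ, ⟪γ w, ·⟫ γ w` (`frameOperator`), which commutes
with `Γ` and whose quadratic form at `w` is at least `‖w‖ ^ 4`. So `M` has an eigenvalue
`μ ≥ ‖w‖ ^ 2` (`norm_pow_four_le_inner_frameOperator_self`, `exists_eigenvalue_ge`). Its eigenspace
`V` is `Γ`-invariant, and is not the line of the all-ones vector, which lies in the kernel of `M`.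
Finally `μ ‖z|_V‖ ^ 2 ≤ ⟪M z, z⟫` (`mul_norm_sq_starProjection_eigenspace_le`) bounds `z|_V`, with a
constant that does not depend on `w`. That independence is what the use of the eigenspace, in place
of the whole span of the orbit of `w`, achieves.
-/

open scoped InnerProductSpace

/-! ### Self-adjoint operators and real sums -/

/-- A symmetric operator has an eigenvalue at least as large as any of its Rayleigh quotients. -/
theorem exists_eigenvalue_ge {E : Type*} [NormedAddCommGroup E] [InnerProductSpace ℝ E]
    [FiniteDimensional ℝ E] {T : E →ₗ[ℝ] E} (hT : T.IsSymmetric) {w : E} (hw : w ≠ 0) {c : ℝ}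
    (h : c * ‖w‖ ^ 2 ≤ ⟪T w, w⟫_ℝ) :
    ∃ μ : ℝ, c ≤ μ ∧ Module.End.HasEigenvalue T μ := by
  by_contra! hlt
  set b := hT.eigenvectorBasis rfl
  have hexp : ⟪T w, w⟫_ℝ = ∑ i, hT.eigenvalues rfl i * ⟪b i, w⟫_ℝ ^ 2 := by
    rw [← b.sum_inner_mul_inner]
    refine Finset.sum_congr rfl fun i _ => ?_
    rw [hT w, hT.apply_eigenvectorBasis, inner_smul_right, real_inner_comm (b i) w]
    simp only [RCLike.ofReal_real_eq_id, id]
    ring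
  have hsum : ∑ i, ⟪b i, w⟫_ℝ ^ 2 = ‖w‖ ^ 2 := by
    simpa using b.sum_sq_norm_inner_right w
  have hev : ∀ i, hT.eigenvalues rfl i < c := fun i => by
    by_contra! hi
    exact hlt _ hi (hT.hasEigenvalue_eigenvalues rfl i)
  rw [hexp, ← hsum, Finset.mul_sum] at h
  obtain ⟨i, hi⟩ : ∃ i, ⟪b i, w⟫_ℝ ≠ 0 := by
    by_contra! hall
    rw [Finset.sum_eq_zero fun i _ => by rw [hall i, zero_pow two_ne_zero]] at hsum
    exact hw (norm_eq_zero.mp (pow_eq_zero_iff two_ne_zero |>.mp hsum.symm))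
  have : ∑ i, hT.eigenvalues rfl i * ⟪b i, w⟫_ℝ ^ 2 < ∑ i, c * ⟪b i, w⟫_ℝ ^ 2 :=
    Finset.sum_lt_sum (fun j _ => mul_le_mul_of_nonneg_right (hev j).le (sq_nonneg _))
      ⟨i, Finset.mem_univ _, mul_lt_mul_of_pos_right (hev i) (by positivity)⟩
  linarith

theorem mul_norm_sq_starProjection_eigenspace_le {E : Type*} [NormedAddCommGroup E]
    [InnerProductSpace ℝ E] [FiniteDimensional ℝ E] {T : E →ₗ[ℝ] E} (hT : T.IsSymmetric)
    (hpos : ∀ x, 0 ≤ ⟪T x, x⟫_ℝ) (μ : ℝ) (z : E) :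
    μ * ‖(Module.End.eigenspace T μ).starProjection z‖ ^ 2 ≤ ⟪T z, z⟫_ℝ := by
  set V := Module.End.eigenspace T μ
  set v := V.starProjection z
  have hv : T v = μ • v := Module.End.mem_eigenspace_iff.mp (V.starProjection_apply_mem z)
  have horth : ⟪v, z - v⟫_ℝ = 0 :=
    V.sub_starProjection_mem_orthogonal z v (V.starProjection_apply_mem z)
  have h1 : ⟪T v, z - v⟫_ℝ = 0 := by rw [hv, inner_smul_left, horth, mul_zero]
  have h2 : ⟪T (z - v), v⟫_ℝ = 0 := by rw [hT, real_inner_comm, h1]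
  have h3 : ⟪T v, v⟫_ℝ = μ * ‖v‖ ^ 2 := by
    rw [hv, real_inner_smul_left, real_inner_self_eq_norm_sq]
  have h4 : ⟪T z, z⟫_ℝ = ⟪T (v + (z - v)), v + (z - v)⟫_ℝ := by
    rw [add_sub_cancel]
  rw [h4, map_add, inner_add_left, inner_add_right, inner_add_right, h1, h2, h3]
  linarith [hpos (z - v)]

/-- An upper bound on the terms of a sum with value zero is also, up to the number of terms, a
bound on their absolute values. -/
theorem sum_sq_le_of_sum_eq_zero {ι : Type*} [Fintype ι] {a : ι → ℝ} {B : ℝ}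
    (hsum : ∑ i, a i = 0) (hB : ∀ i, a i ≤ B) :
    ∑ i, a i ^ 2 ≤ (Fintype.card ι : ℝ) ^ 3 * B ^ 2 := by
  have key : ∀ i, a i ^ 2 ≤ ((Fintype.card ι : ℝ) * B) ^ 2 := fun i => by
    have h1 : B - a i ≤ ∑ j, (B - a j) :=
      Finset.single_le_sum (f := fun j => B - a j) (fun j _ => sub_nonneg.mpr (hB j))
        (Finset.mem_univ i)
    rw [Finset.sum_sub_distrib, hsum, sub_zero, Finset.sum_const, Finset.card_univ,
      nsmul_eq_mul] at h1
    have h2 : 0 ≤ (Fintype.card ι : ℝ) * B := by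
      have := Finset.sum_le_sum fun j (_ : j ∈ Finset.univ) => hB j
      rwa [hsum, Finset.sum_const, Finset.card_univ, nsmul_eq_mul] at this
    have hc : (1 : ℝ) ≤ Fintype.card ι := by
      exact_mod_cast Fintype.card_pos_iff.mpr ⟨i⟩
    have hB0 : 0 ≤ B := nonneg_of_mul_nonneg_right h2 (by linarith)
    exact sq_le_sq' (by linarith) ((hB i).trans (le_mul_of_one_le_left hB0 hc))
  calc ∑ i, a i ^ 2 ≤ ∑ _i : ι, ((Fintype.card ι : ℝ) * B) ^ 2 :=
        Finset.sum_le_sum fun i _ => key i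
    _ = (Fintype.card ι : ℝ) ^ 3 * B ^ 2 := by
        rw [Finset.sum_const, Finset.card_univ, nsmul_eq_mul]
        ring

namespace CorePoints

variable {n : ℕ}

/-! ### The permutation action -/

theorem permAct_mul (σ τ : Equiv.Perm (Fin n)) (x : EuclideanSpace ℝ (Fin n)) :
    permAct (σ * τ) x = permAct σ (permAct τ x) := by
  ext i
  simp only [permAct_apply, mul_inv_rev, Equiv.Perm.mul_apply]

theorem permAct_one (x : EuclideanSpace ℝ (Fin n)) : permAct 1 x = x := by
  ext i
  simp only [permAct_apply, inv_one, Equiv.Perm.one_apply]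

theorem permAct_ones (σ : Equiv.Perm (Fin n)) : permAct σ (ones n) = ones n := by
  ext i
  simp [permAct_apply, ones]

theorem inner_permAct_left (σ : Equiv.Perm (Fin n)) (x y : EuclideanSpace ℝ (Fin n)) :
    ⟪permAct σ x, y⟫_ℝ = ⟪x, permAct σ⁻¹ y⟫_ℝ := by
  rw [← LinearIsometryEquiv.inner_map_map (permAct σ) x, ← permAct_mul, mul_inv_cancel,
    permAct_one]

theorem inner_ones_permAct (σ : Equiv.Perm (Fin n)) (x : EuclideanSpace ℝ (Fin n)) :
    ⟪ones n, permAct σ x⟫_ℝ = ⟪ones n, x⟫_ℝ := by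
  rw [← LinearIsometryEquiv.inner_map_map (permAct σ) (ones n) x, permAct_ones]

theorem inner_ones (x : EuclideanSpace ℝ (Fin n)) : ⟪ones n, x⟫_ℝ = ∑ i, x i := by
  simp [PiLp.inner_apply, ones]

theorem inner_ones_ones : ⟪ones n, ones n⟫_ℝ = n := by
  rw [inner_ones]
  simp [ones]

theorem ones_ne_zero (hn : 0 < n) : ones n ≠ 0 := fun h => by
  have := inner_ones_ones (n := n)
  rw [h, inner_zero_left] at this
  exact hn.ne (by exact_mod_cast this)

theorem isInvariantSubspace_of_map_mem {Γ : Subgroup (Equiv.Perm (Fin n))}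
    {V : Submodule ℝ (EuclideanSpace ℝ (Fin n))}
    (h : ∀ γ ∈ Γ, ∀ x ∈ V, permAct γ x ∈ V) : IsInvariantSubspace Γ V := by
  intro γ hγ
  refine Set.Subset.antisymm (Set.image_subset_iff.mpr fun x hx => h γ hγ x hx) fun x hx =>
    ⟨permAct γ⁻¹ x, h _ (Γ.inv_mem hγ) x hx, ?_⟩
  rw [← permAct_mul, mul_inv_cancel, permAct_one]

theorem fixedSpace_eq_span_ones (hn : 0 < n) {Γ : Subgroup (Equiv.Perm (Fin n))}
    (hΓ : MulAction.IsPretransitive Γ (Fin n)) : fixedSpace Γ = Submodule.span ℝ {ones n} := by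
  ext x
  rw [Submodule.mem_span_singleton]
  constructor
  · intro hx
    refine ⟨x ⟨0, hn⟩, ?_⟩
    ext i
    obtain ⟨g, hg⟩ := hΓ.exists_smul_eq i ⟨0, hn⟩
    have h := congrArg (fun y => y ⟨0, hn⟩) (hx g g.2)
    have hg' : (g : Equiv.Perm (Fin n)) i = ⟨0, hn⟩ := hg
    simp only [permAct_apply, Equiv.Perm.inv_eq_iff_eq.mpr hg'.symm] at h
    simp [ones, h]
  · rintro ⟨c, rfl⟩ γ -
    rw [map_smul, permAct_ones]

open scoped Classical in
theorem sum_permAct_eq_zero (hn : 0 < n) {Γ : Subgroup (Equiv.Perm (Fin n))}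
    (hΓ : MulAction.IsPretransitive Γ (Fin n)) {w : EuclideanSpace ℝ (Fin n)}
    (hw : ⟪ones n, w⟫_ℝ = 0) : ∑ γ : Γ, permAct (γ : Equiv.Perm (Fin n)) w = 0 := by
  have hfix : ∑ γ : Γ, permAct (γ : Equiv.Perm (Fin n)) w ∈ fixedSpace Γ := by
    intro δ hδ
    rw [map_sum]
    refine Fintype.sum_equiv (Equiv.mulLeft (⟨δ, hδ⟩ : Γ)) _ _ fun γ => ?_
    simp [permAct_mul]
  have horth : ⟪ones n, ∑ γ : Γ, permAct (γ : Equiv.Perm (Fin n)) w⟫_ℝ = 0 := by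
    simp [inner_sum, inner_ones_permAct, hw]
  rw [fixedSpace_eq_span_ones hn hΓ, Submodule.mem_span_singleton] at hfix
  obtain ⟨c, hc⟩ := hfix
  rw [← hc, inner_smul_right, inner_ones_ones] at horth
  rw [← hc, (mul_eq_zero.mp horth).resolve_right (by exact_mod_cast hn.ne'), zero_smul]

/-! ### The frame operator of an orbit -/

open scoped Classical in
/-- The operator `x ↦ ∑ γ, ⟪γ w, x⟫ γ w`. The sum runs over the group, so that points of the
orbit of `w` with a nontrivial stabilizer are counted with multiplicity. -/
noncomputable def frameOperator (Γ : Subgroup (Equiv.Perm (Fin n)))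
    (w : EuclideanSpace ℝ (Fin n)) :
    EuclideanSpace ℝ (Fin n) →ₗ[ℝ] EuclideanSpace ℝ (Fin n) :=
  ∑ γ : Γ, (innerₛₗ ℝ (permAct (γ : Equiv.Perm (Fin n)) w)).smulRight
    (permAct (γ : Equiv.Perm (Fin n)) w)

open scoped Classical in
theorem frameOperator_apply (Γ : Subgroup (Equiv.Perm (Fin n)))
    (w x : EuclideanSpace ℝ (Fin n)) :
    frameOperator Γ w x = ∑ γ : Γ, ⟪permAct (γ : Equiv.Perm (Fin n)) w, x⟫_ℝ •
      permAct (γ : Equiv.Perm (Fin n)) w := by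
  simp [frameOperator]

open scoped Classical in
theorem inner_frameOperator (Γ : Subgroup (Equiv.Perm (Fin n)))
    (w x y : EuclideanSpace ℝ (Fin n)) :
    ⟪frameOperator Γ w x, y⟫_ℝ = ∑ γ : Γ, ⟪permAct (γ : Equiv.Perm (Fin n)) w, x⟫_ℝ *
      ⟪permAct (γ : Equiv.Perm (Fin n)) w, y⟫_ℝ := by
  simp [frameOperator_apply, sum_inner, real_inner_smul_left]

open scoped Classical in
theorem inner_frameOperator_self (Γ : Subgroup (Equiv.Perm (Fin n)))
    (w x : EuclideanSpace ℝ (Fin n)) :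
    ⟪frameOperator Γ w x, x⟫_ℝ =
      ∑ γ : Γ, ⟪permAct (γ : Equiv.Perm (Fin n)) w, x⟫_ℝ ^ 2 := by
  simp [inner_frameOperator, sq]

theorem inner_frameOperator_self_nonneg (Γ : Subgroup (Equiv.Perm (Fin n)))
    (w x : EuclideanSpace ℝ (Fin n)) : 0 ≤ ⟪frameOperator Γ w x, x⟫_ℝ := by
  rw [inner_frameOperator_self]
  positivity

theorem isSymmetric_frameOperator (Γ : Subgroup (Equiv.Perm (Fin n)))
    (w : EuclideanSpace ℝ (Fin n)) : (frameOperator Γ w).IsSymmetric := by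
  intro x y
  rw [real_inner_comm (frameOperator Γ w y), inner_frameOperator, inner_frameOperator]
  exact Finset.sum_congr rfl fun _ _ => mul_comm _ _

open scoped Classical in
theorem frameOperator_permAct {Γ : Subgroup (Equiv.Perm (Fin n))} {δ : Equiv.Perm (Fin n)}
    (hδ : δ ∈ Γ) (w x : EuclideanSpace ℝ (Fin n)) :
    frameOperator Γ w (permAct δ x) = permAct δ (frameOperator Γ w x) := by
  rw [frameOperator_apply, frameOperator_apply, map_sum]
  refine (Fintype.sum_equiv (Equiv.mulLeft (⟨δ, hδ⟩ : Γ)) _ _ fun γ => ?_).symm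
  simp [permAct_mul, LinearIsometryEquiv.inner_map_map]

theorem frameOperator_ones (Γ : Subgroup (Equiv.Perm (Fin n))) {w : EuclideanSpace ℝ (Fin n)}
    (hw : ⟪ones n, w⟫_ℝ = 0) : frameOperator Γ w (ones n) = 0 := by
  rw [frameOperator_apply]
  refine Finset.sum_eq_zero fun γ _ => ?_
  rw [real_inner_comm, inner_ones_permAct, hw, zero_smul]

open scoped Classical in
/-- The term of the identity alone contributes `‖w‖ ^ 4`. -/
theorem norm_pow_four_le_inner_frameOperator_self (Γ : Subgroup (Equiv.Perm (Fin n)))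
    (w : EuclideanSpace ℝ (Fin n)) :
    ‖w‖ ^ 2 * ‖w‖ ^ 2 ≤ ⟪frameOperator Γ w w, w⟫_ℝ := by
  rw [inner_frameOperator_self]
  have h := Finset.single_le_sum
    (f := fun γ : Γ => ⟪permAct (γ : Equiv.Perm (Fin n)) w, w⟫_ℝ ^ 2)
    (fun _ _ => sq_nonneg _) (Finset.mem_univ (1 : Γ))
  simp only [Subgroup.coe_one, permAct_one, real_inner_self_eq_norm_sq] at h
  rwa [← sq]

/-! ### Integral points near the diagonal -/

/-- The integral point has entries `q` and `q + 1`, where `q` is the quotient of the coordinate sum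
by `n`. -/
theorem exists_integral_near_diagonal (hn : 0 < n) {z : EuclideanSpace ℝ (Fin n)}
    (hz : z ∈ integralPoints n) :
    ∃ p ∈ integralPoints n, ∃ q : ℝ, ⟪ones n, p⟫_ℝ = ⟪ones n, z⟫_ℝ ∧
      ‖p - q • ones n‖ ≤ √n := by
  choose m hm using hz
  set k := ∑ i, m i with hk
  have hn' : (0 : ℤ) < n := by exact_mod_cast hn
  obtain ⟨r, hr⟩ : ∃ r : ℕ, k % n = r := Int.eq_ofNat_of_zero_le (Int.emod_nonneg k hn'.ne')
  have hrn : r < n := by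
    have := Int.emod_lt_of_pos k hn'
    omega
  refine ⟨WithLp.toLp 2 fun i : Fin n => ((k / n : ℤ) : ℝ) + if (i : ℕ) < r then 1 else 0,
    fun i => ⟨k / n + if (i : ℕ) < r then 1 else 0, by push_cast; simp⟩, ((k / n : ℤ) : ℝ),
    ?_, ?_⟩
  · have hcard : (Finset.univ.filter fun i : Fin n => (i : ℕ) < r).card = r := by
      rw [Fin.card_filter_val_lt, min_eq_right hrn.le]
    have hdiv : (n : ℤ) * (k / n) + r = k := by
      rw [← hr]
      exact Int.mul_ediv_add_emod k n
    rw [inner_ones, inner_ones]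
    simp only [hm, Finset.sum_add_distrib, Finset.sum_boole, hcard]
    rw [← Int.cast_sum Finset.univ m, ← hk, Finset.sum_const, Finset.card_univ, Fintype.card_fin,
      nsmul_eq_mul]
    exact_mod_cast hdiv
  · rw [EuclideanSpace.norm_eq]
    refine Real.sqrt_le_sqrt ?_
    calc _ ≤ ∑ _i : Fin n, (1 : ℝ) := Finset.sum_le_sum fun i _ => by
            simp only [ones, PiLp.sub_apply, PiLp.smul_apply, smul_eq_mul, mul_one,
              add_sub_cancel_left]
            split_ifs <;> simp
      _ = n := by simp

theorem finite_orbit (Γ : Subgroup (Equiv.Perm (Fin n))) (z : EuclideanSpace ℝ (Fin n)) :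
    (orbit Γ z).Finite :=
  (Set.toFinite (Γ : Set (Equiv.Perm (Fin n)))).image fun γ => permAct γ z

/-- Separation of `p` from the orbit polytope by a vector orthogonal to the all-ones vector. -/
theorem exists_separating_vector (hn : 0 < n) {Γ : Subgroup (Equiv.Perm (Fin n))}
    {z p : EuclideanSpace ℝ (Fin n)} (hp : ⟪ones n, p⟫_ℝ = ⟪ones n, z⟫_ℝ)
    (hmem : p ∉ convexHull ℝ (orbit Γ z)) :
    ∃ w, ⟪ones n, w⟫_ℝ = 0 ∧ ∀ γ ∈ Γ, ⟪permAct γ w, z⟫_ℝ < ⟪w, p⟫_ℝ := by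
  obtain ⟨f, c, hf, hc⟩ := geometric_hahn_banach_closed_point (convex_convexHull ℝ (orbit Γ z))
    ((finite_orbit Γ z).isClosed_convexHull ℝ) hmem
  set u := (InnerProductSpace.toDual ℝ _).symm f
  have hu : ∀ x, f x = ⟪u, x⟫_ℝ := fun x => by simp [u]
  have hn' : (n : ℝ) ≠ 0 := by exact_mod_cast hn.ne'
  refine ⟨u - (⟪ones n, u⟫_ℝ / n) • ones n, ?_, fun γ hγ => ?_⟩
  · rw [inner_sub_right, inner_smul_right, inner_ones_ones]
    field_simp
    simp
  · have h := (hf _ (subset_convexHull ℝ _ ⟨γ⁻¹, Γ.inv_mem hγ, rfl⟩)).trans hc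
    rw [hu, hu] at h
    rw [inner_permAct_left, inner_sub_left, inner_sub_left, real_inner_smul_left,
      real_inner_smul_left, inner_ones_permAct, hp]
    linarith

/-! ### Invariant subspaces with bounded projection -/

theorem isInvariantSubspace_orthogonal_ones (Γ : Subgroup (Equiv.Perm (Fin n))) :
    IsInvariantSubspace Γ (Submodule.span ℝ {ones n})ᗮ := by
  refine isInvariantSubspace_of_map_mem fun γ _ x hx => ?_
  rw [Submodule.mem_orthogonal_singleton_iff_inner_right] at hx ⊢
  rw [inner_ones_permAct, hx]

theorem orthogonal_ones_ne_bot (hn : 2 ≤ n) :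
    (Submodule.span ℝ {ones n})ᗮ ≠ ⊥ := by
  intro h
  rw [Submodule.orthogonal_eq_bot_iff] at h
  have h1 := finrank_span_singleton (K := ℝ) (ones_ne_zero (n := n) (by omega))
  rw [h, finrank_top, finrank_euclideanSpace_fin] at h1
  omega

theorem orthogonal_ones_ne_span (hn : 0 < n) :
    (Submodule.span ℝ {ones n})ᗮ ≠ Submodule.span ℝ {ones n} := by
  intro h
  have h1 : ones n ∈ (Submodule.span ℝ {ones n})ᗮ := by
    rw [h]
    exact Submodule.mem_span_singleton_self _
  rw [Submodule.mem_orthogonal_singleton_iff_inner_right, inner_self_eq_zero] at h1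
  exact ones_ne_zero hn h1

theorem norm_starProjection_orthogonal_ones_le (x : EuclideanSpace ℝ (Fin n)) (q : ℝ) :
    ‖(Submodule.span ℝ {ones n})ᗮ.starProjection x‖ ≤ ‖x - q • ones n‖ := by
  have h : (Submodule.span ℝ {ones n})ᗮ.starProjection (q • ones n) = 0 := by
    rw [Submodule.starProjection_apply_eq_zero_iff]
    exact Submodule.le_orthogonal_orthogonal _
      (Submodule.smul_mem _ _ (Submodule.mem_span_singleton_self _))
  calc _ = ‖(Submodule.span ℝ {ones n})ᗮ.starProjection (x - q • ones n)‖ := by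
        rw [map_sub, h, sub_zero]
    _ ≤ ‖x - q • ones n‖ := Submodule.norm_starProjection_apply_le _ _

/-- If the coordinates `⟪γ w, z⟫` of `z` along the orbit of `w` are bounded above relative to `‖w‖`,
then some eigenspace of the frame operator of `w` witnesses the bound for `z`. -/
theorem exists_invariantSubspace_of_inner_le (hn : 0 < n) {Γ : Subgroup (Equiv.Perm (Fin n))}
    (hΓ : MulAction.IsPretransitive Γ (Fin n)) {w z : EuclideanSpace ℝ (Fin n)}
    (hw0 : w ≠ 0) (hw : ⟪ones n, w⟫_ℝ = 0) {R : ℝ}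
    (hR : ∀ γ ∈ Γ, ⟪permAct γ w, z⟫_ℝ ≤ R * ‖w‖) :
    ∃ V : Submodule ℝ (EuclideanSpace ℝ (Fin n)), IsInvariantSubspace Γ V ∧ V ≠ ⊥ ∧
      V ≠ Submodule.span ℝ {ones n} ∧
      ‖V.starProjection z‖ ^ 2 ≤ (Fintype.card (Equiv.Perm (Fin n)) : ℝ) ^ 3 * R ^ 2 := by
  classical
  have hwpos : 0 < ‖w‖ ^ 2 := by positivity
  have hT := isSymmetric_frameOperator Γ w
  obtain ⟨μ, hμ, hev⟩ := exists_eigenvalue_ge hT hw0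
    (norm_pow_four_le_inner_frameOperator_self Γ w)
  refine ⟨Module.End.eigenspace (frameOperator Γ w) μ, ?_, hev, fun h => ?_, ?_⟩
  · refine isInvariantSubspace_of_map_mem fun γ hγ x hx => ?_
    rw [Module.End.mem_eigenspace_iff] at hx ⊢
    rw [frameOperator_permAct hγ, hx, map_smul]
  · have h1 : ones n ∈ Module.End.eigenspace (frameOperator Γ w) μ := by
      rw [h]
      exact Submodule.mem_span_singleton_self _
    rw [Module.End.mem_eigenspace_iff, frameOperator_ones Γ hw] at h1
    rcases smul_eq_zero.mp h1.symm with h2 | h2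
    · linarith
    · exact ones_ne_zero hn h2
  · have hsum : ∑ γ : Γ, ⟪permAct (γ : Equiv.Perm (Fin n)) w, z⟫_ℝ = 0 := by
      rw [← sum_inner, sum_permAct_eq_zero hn hΓ hw, inner_zero_left]
    have h1 := mul_norm_sq_starProjection_eigenspace_le hT
      (inner_frameOperator_self_nonneg Γ w) μ z
    rw [inner_frameOperator_self] at h1
    have h2 := sum_sq_le_of_sum_eq_zero hsum fun γ => hR γ γ.2
    have hcard : (Fintype.card Γ : ℝ) ≤ Fintype.card (Equiv.Perm (Fin n)) := by
      exact_mod_cast Fintype.card_subtype_le _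
    refine le_of_mul_le_mul_left ?_ hwpos
    calc _ ≤ μ * ‖(Module.End.eigenspace (frameOperator Γ w) μ).starProjection z‖ ^ 2 := by
          gcongr
      _ ≤ (Fintype.card Γ : ℝ) ^ 3 * (R * ‖w‖) ^ 2 := h1.trans h2
      _ ≤ (Fintype.card (Equiv.Perm (Fin n)) : ℝ) ^ 3 * (R * ‖w‖) ^ 2 := by gcongr
      _ = _ := by ring

end CorePoints

open CorePoints in
theorem mainTheorem2 (n : ℕ) (hn : 2 ≤ n) :
    ∃ C : ℝ, ∀ Γ : Subgroup (Equiv.Perm (Fin n)), MulAction.IsPretransitive Γ (Fin n) →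
      CorePoints.fixedSpace Γ = Submodule.span ℝ {CorePoints.ones n} ∧
      ∀ z : EuclideanSpace ℝ (Fin n), CorePoints.IsCorePoint Γ z →
        ∃ V : Submodule ℝ (EuclideanSpace ℝ (Fin n)),
          CorePoints.IsInvariantSubspace Γ V ∧ V ≠ ⊥ ∧ V ≠ CorePoints.fixedSpace Γ ∧
          ‖V.starProjection z‖ ≤ C := by
  have hn0 : 0 < n := by omega
  refine ⟨√((Fintype.card (Equiv.Perm (Fin n)) : ℝ) ^ 3 * √n ^ 2), fun Γ hΓ =>
    ⟨fixedSpace_eq_span_ones hn0 hΓ, fun z hz => ?_⟩⟩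
  rw [fixedSpace_eq_span_ones hn0 hΓ]
  obtain ⟨p, hpint, q, hp, hpq⟩ := exists_integral_near_diagonal hn0 hz.1
  by_cases hmem : p ∈ convexHull ℝ (orbit Γ z)
  · have horb : p ∈ orbit Γ z := hz.2 ▸ ⟨hmem, hpint⟩
    obtain ⟨γ, -, rfl⟩ := horb
    refine ⟨_, isInvariantSubspace_orthogonal_ones Γ, orthogonal_ones_ne_bot hn,
      orthogonal_ones_ne_span hn0, ?_⟩
    have hnorm : ‖permAct γ z - q • ones n‖ = ‖z - q • ones n‖ := by
      rw [← LinearIsometryEquiv.norm_map (permAct γ) (z - q • ones n), map_sub, map_smul,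
        permAct_ones]
    refine (norm_starProjection_orthogonal_ones_le z q).trans (hnorm ▸ hpq.trans ?_)
    refine Real.le_sqrt_of_sq_le (le_mul_of_one_le_left (sq_nonneg _) (one_le_pow₀ ?_))
    exact_mod_cast Fintype.card_pos
  · obtain ⟨w, hw, hsep⟩ := exists_separating_vector hn0 hp hmem
    have hw0 : w ≠ 0 := by
      rintro rfl
      simpa using hsep 1 Γ.one_mem
    -- Orthogonality to the all-ones vector allows replacing `p` by its offset from the diagonal.
    have hwp : ⟪w, p⟫_ℝ ≤ √n * ‖w‖ := by
      have h1 : ⟪w, p⟫_ℝ = ⟪w, p - q • ones n⟫_ℝ := by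
        rw [inner_sub_right, inner_smul_right, real_inner_comm, real_inner_comm (ones n), hw]
        simp
      rw [h1, mul_comm]
      exact (real_inner_le_norm _ _).trans (by gcongr)
    obtain ⟨V, hinv, hbot, hne, hV⟩ := exists_invariantSubspace_of_inner_le hn0 hΓ hw0 hw
      fun γ hγ => (hsep γ hγ).le.trans hwp
    exact ⟨V, hinv, hbot, hne, Real.le_sqrt_of_sq_le hV⟩
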